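/- Let $\mathcal M=\mathbb R^4$ carry the Minkowski inner product $\eta=\mathrm{diag}(1,-1,-1,-1)$ (units with $c=1$). A vector $v$ is timelike if $\eta(v,v)>0$ and spacelike if $\eta(v,v)<0$. A causal automorphism is a bijection $f:\mathcal M\to\mathcal M$ (not assumed continuous) such that, for all $p,q\in\mathcal M$, $p-q$ is non-spacelike if and only if $f(p)-f(q)$ is non-spacelike. Let $X\subset\mathcal M$ be a timelike straight line, and let $\mathrm{Aut}^{\rm c}_X$ be the group of causal automorphisms $f$ with $f(X)=X$. Let $S$ be an equivalence relation on $\mathcal M$ that is non-trivial, i.e. neither equality nor the relation with only one class, and that is invariant under $\mathrm{Aut}^{\rm c}_X$: $S(p,q)\Leftrightarrow S(f(p),f(q))$ for all $f\in\mathrm{Aut}^{\rm c}_X$ and all $p,q\in\mathcal M$. Suppose that there are $p\in X$ and $q\notin X$ with $S(p,q)$. Then $S$ is standard Einstein simultaneity relative to $X$: $S(p,q)$ holds if and only if $p-q$ is $\eta$-orthogonal to the direction of $X$, i.e. the equivalence classes of $S$ are exactly the hyperplanes $\eta$-orthogonal to $X$. -/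

import Mathlib

open scoped Pointwise

/-- Flat spacetime `ℝ⁴`, with points written as `(t, x₁, x₂, x₃)`, in units with `c = 1`. -/
abbrev Spacetime : Type := Fin 4 → ℝ

/-- The Minkowski inner product with `η = diag (1, -1, -1, -1)`. -/
def minkowski (v w : Spacetime) : ℝ :=
  v 0 * w 0 - ∑ i : Fin 3, v i.succ * w i.succ

/-- Timelike vectors. -/
def IsTimelike (v : Spacetime) : Prop := 0 < minkowski v v

/-- Spacelike vectors. -/
def IsSpacelike (v : Spacetime) : Prop := minkowski v v < 0

/-- Timelike straight lines (inertial observers). -/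
def IsTimelikeLine (X : Set Spacetime) : Prop :=
  ∃ a u : Spacetime, IsTimelike u ∧ X = Set.range (fun s : ℝ => a + s • u)

/-- The group of causal automorphisms: all bijections `f` of spacetime (no continuity or linearity
is required) such that `p - q` is non-spacelike iff `f p - f q` is non-spacelike. -/
def causalAut : Subgroup (Equiv.Perm Spacetime) where
  carrier := {f | ∀ p q : Spacetime, ¬ IsSpacelike (p - q) ↔ ¬ IsSpacelike (f p - f q)}
  one_mem' := fun _ _ => Iff.rfl
  mul_mem' := fun {f g} hf hg p q => (hg p q).trans (hf (g p) (g q))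
  inv_mem' := fun {f} hf p q => by
    simpa using (hf (f⁻¹ p) (f⁻¹ q)).symm

/-- The causal automorphisms `f` that stabilise the set `X`, i.e. `f '' X = X`
(`X` need not be fixed pointwise). -/
def causalAutStab (X : Set Spacetime) : Subgroup (Equiv.Perm Spacetime) :=
  causalAut ⊓ MulAction.stabilizer (Equiv.Perm Spacetime) X

/-- An equivalence relation is invariant under a group `G` of bijections. -/
def Setoid.InvariantUnder (S : Setoid Spacetime) (G : Subgroup (Equiv.Perm Spacetime)) : Prop :=
  ∀ g ∈ G, ∀ p q : Spacetime, S p q ↔ S (g p) (g q)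

/-- An equivalence relation is non-trivial if it is neither equality (`⊥`, every point is its own
class) nor the relation with just one class (`⊤`). -/
def Setoid.NonTrivial (S : Setoid Spacetime) : Prop := S ≠ ⊥ ∧ S ≠ ⊤

/-- Standard Einstein simultaneity relative to a line `X`: two events are simultaneous iff their
difference is Minkowski-orthogonal to `X`. The classes are the hyperplanes orthogonal to `X`. -/
def einsteinSimultaneity (X : Set Spacetime) : Setoid Spacetime where
  r p q := ∀ a ∈ X, ∀ b ∈ X, minkowski (p - q) (b - a) = 0
  iseqv :=
    { refl := fun p a _ b _ => by simp [minkowski]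
      symm := fun {p q} h a ha b hb => by
        have h1 := h a ha b hb
        simp only [minkowski, Fin.sum_univ_three, Pi.sub_apply] at h1 ⊢
        linarith
      trans := fun {p q r} h h' a ha b hb => by
        have h1 := h a ha b hb
        have h2 := h' a ha b hb
        simp only [minkowski, Fin.sum_univ_three, Pi.sub_apply] at h1 h2 ⊢
        linarith }

/-!
Write `X = a + ℝ u`. Besides translations along `u`, the stabiliser of `X` contains all linear
similarities of the Minkowski form, centred at `a`, that preserve the line `ℝ u`. Three kinds are
enough: homotheties (with positive or negative factor), the time reflection in `u`, and the
spatial reflections in vectors `w ⊥ u`. As `u⊥` is negative definite, homotheties and spatial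
reflections together act transitively on its non-zero vectors
(`exists_similarity_map_orthogonal`).

With `a` as origin, let `0` be related to `t u + x` with `0 ≠ x ⊥ u`.

* If two distinct points of the line are related, homotheties and translations make the whole line
  one class (`SimilarityInvariant.line_of_ne`). Every point off the line is related to some point
  on it by transitivity of the action on `u⊥`, so there is only one class
  (`SimilarityInvariant.top_of_line`). Hence no two distinct points of the line are related.
* If `t ≠ 0`, time reflection about the event `t u` fixes `t u + x` and sends `0` to `2 t u`, so
  `0` and `2 t u` are related, which is excluded. Hence `t = 0`.
* With `t = 0`, transitivity shows that every point is related to its orthogonal projection to the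
  line; so two points are related exactly if their projections are, that is, exactly if the
  projections coincide.
-/

/-- The Minkowski inner product as a bilinear form. -/
noncomputable def minkowskiForm : LinearMap.BilinForm ℝ Spacetime :=
  LinearMap.mk₂ ℝ minkowski
    (fun v v' w => by simp [minkowski, Fin.sum_univ_three]; ring)
    (fun c v w => by simp [minkowski, Fin.sum_univ_three]; ring)
    (fun v w w' => by simp [minkowski, Fin.sum_univ_three]; ring)
    (fun c v w => by simp [minkowski, Fin.sum_univ_three]; ring)

theorem minkowskiForm_apply (v w : Spacetime) : minkowskiForm v w = minkowski v w := rfl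

theorem minkowskiForm_comm (v w : Spacetime) : minkowskiForm v w = minkowskiForm w v := by
  simp only [minkowskiForm_apply, minkowski, mul_comm]

/-- The orthogonal complement of a timelike vector is negative definite: this is the
Cauchy–Schwarz inequality for the spatial parts. -/
theorem minkowskiForm_self_neg {u x : Spacetime} (hu : IsTimelike u)
    (hx : minkowskiForm x u = 0) (hx0 : x ≠ 0) : minkowskiForm x x < 0 := by
  by_contra! h
  simp only [IsTimelike, minkowskiForm_apply, minkowski, Fin.sum_univ_three] at hu hx h
  set x1 := x (Fin.succ 0)
  set x2 := x (Fin.succ 1)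
  set x3 := x (Fin.succ 2)
  set u1 := u (Fin.succ 0)
  set u2 := u (Fin.succ 1)
  set u3 := u (Fin.succ 2)
  have cs : (x1 * u1 + x2 * u2 + x3 * u3) ^ 2
      ≤ (x1 ^ 2 + x2 ^ 2 + x3 ^ 2) * (u1 ^ 2 + u2 ^ 2 + u3 ^ 2) := by
    nlinarith [sq_nonneg (x1 * u2 - x2 * u1), sq_nonneg (x1 * u3 - x3 * u1),
      sq_nonneg (x2 * u3 - x3 * u2)]
  have e : x1 * u1 + x2 * u2 + x3 * u3 = x 0 * u 0 := by linarith
  rw [e] at cs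
  have hle : (x1 ^ 2 + x2 ^ 2 + x3 ^ 2) * (u1 ^ 2 + u2 ^ 2 + u3 ^ 2)
      ≤ x 0 ^ 2 * (u1 ^ 2 + u2 ^ 2 + u3 ^ 2) :=
    mul_le_mul_of_nonneg_right (by nlinarith) (by positivity)
  have h0 : x 0 ^ 2 = 0 := by
    by_contra hne
    have : 0 < x 0 ^ 2 := lt_of_le_of_ne (sq_nonneg _) (Ne.symm hne)
    have := mul_pos this hu
    nlinarith
  have g1 : x1 = 0 := by nlinarith [sq_nonneg x1, sq_nonneg x2, sq_nonneg x3]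
  have g2 : x2 = 0 := by nlinarith [sq_nonneg x1, sq_nonneg x2, sq_nonneg x3]
  have g3 : x3 = 0 := by nlinarith [sq_nonneg x1, sq_nonneg x2, sq_nonneg x3]
  have g0 : x 0 = 0 := by simpa using h0
  apply hx0
  ext i
  fin_cases i
  exacts [g0, g1, g2, g3]

/-- Orthogonal decomposition of a vector with respect to a timelike vector. -/
theorem exists_eq_smul_add_orthogonal {u : Spacetime} (hu : IsTimelike u) (v : Spacetime) :
    ∃ (t : ℝ) (x : Spacetime), minkowskiForm x u = 0 ∧ v = t • u + x := by
  have hu' : minkowskiForm u u ≠ 0 := ne_of_gt hu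
  refine ⟨minkowskiForm v u / minkowskiForm u u,
    v - (minkowskiForm v u / minkowskiForm u u) • u, ?_, by abel⟩
  simp [hu']

/-! ### Similarities preserving a line -/

/-- `L` multiplies the Minkowski form by a positive factor and maps the line `ℝ u` onto itself. -/
def IsSimilarityAlong (u : Spacetime) (L : Spacetime ≃ₗ[ℝ] Spacetime) : Prop :=
  (∃ c : ℝ, 0 < c ∧ ∀ v, minkowskiForm (L v) (L v) = c * minkowskiForm v v) ∧
    ∃ k : ℝ, k ≠ 0 ∧ L u = k • u

theorem IsSimilarityAlong.trans {u : Spacetime} {L M : Spacetime ≃ₗ[ℝ] Spacetime}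
    (hL : IsSimilarityAlong u L) (hM : IsSimilarityAlong u M) :
    IsSimilarityAlong u (L.trans M) := by
  obtain ⟨⟨c, hc, hc'⟩, k, hk, hk'⟩ := hL
  obtain ⟨⟨d, hd, hd'⟩, l, hl, hl'⟩ := hM
  refine ⟨⟨d * c, mul_pos hd hc, fun v => ?_⟩, k * l, mul_ne_zero hk hl, ?_⟩
  · rw [LinearEquiv.trans_apply, hd', hc', mul_assoc]
  · rw [LinearEquiv.trans_apply, hk', map_smul, hl', smul_smul]

theorem isSimilarityAlong_homothety (u : Spacetime) {r : ℝ} (hr : r ≠ 0) :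
    IsSimilarityAlong u (LinearEquiv.smulOfNeZero ℝ Spacetime r hr) := by
  refine ⟨⟨r ^ 2, by positivity, fun v => ?_⟩, r, hr, by simp⟩
  simp; ring

/-- The reflection `v ↦ v - (2 η(v, w) / η(w, w)) w` in a vector that is not lightlike. -/
noncomputable def minkowskiReflection (w : Spacetime) (hw : minkowskiForm w w ≠ 0) :
    Spacetime ≃ₗ[ℝ] Spacetime :=
  Module.reflection (x := w) (f := (2 / minkowskiForm w w) • minkowskiForm.flip w) (by
    simp [hw])

theorem minkowskiReflection_apply {w : Spacetime} (hw : minkowskiForm w w ≠ 0) (v : Spacetime) :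
    minkowskiReflection w hw v = v - (2 / minkowskiForm w w * minkowskiForm v w) • w := by
  simp [minkowskiReflection, Module.reflection_apply]

theorem minkowskiForm_reflection {w : Spacetime} (hw : minkowskiForm w w ≠ 0) (v : Spacetime) :
    minkowskiForm (minkowskiReflection w hw v) (minkowskiReflection w hw v)
      = minkowskiForm v v := by
  simp only [minkowskiReflection_apply, map_sub, map_smul, LinearMap.sub_apply,
    LinearMap.smul_apply, smul_eq_mul, minkowskiForm_comm w v]
  field_simp
  ring

theorem minkowskiReflection_of_orthogonal {w v : Spacetime} (hw : minkowskiForm w w ≠ 0)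
    (h : minkowskiForm v w = 0) : minkowskiReflection w hw v = v := by
  simp [minkowskiReflection_apply, h]

theorem minkowskiReflection_self {w : Spacetime} (hw : minkowskiForm w w ≠ 0) :
    minkowskiReflection w hw w = -w := by
  rw [minkowskiReflection_apply, div_mul_cancel₀ _ hw, two_smul]
  abel

/-- The similarities preserving the line spanned by a timelike vector `u` act transitively on the
non-zero vectors orthogonal to `u`. -/
theorem exists_similarity_map_orthogonal {u x y : Spacetime} (hu : IsTimelike u)
    (hx : minkowskiForm x u = 0) (hx0 : x ≠ 0) (hy : minkowskiForm y u = 0) (hy0 : y ≠ 0) :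
    ∃ L, IsSimilarityAlong u L ∧ L x = y := by
  have hxx := minkowskiForm_self_neg hu hx hx0
  have hyy := minkowskiForm_self_neg hu hy hy0
  have hq : 0 < minkowskiForm y y / minkowskiForm x x := div_pos_of_neg_of_neg hyy hxx
  -- the homothety by `r` gives `x` the length of `y`
  set r := Real.sqrt (minkowskiForm y y / minkowskiForm x x)
  have hr : r ≠ 0 := (Real.sqrt_pos.mpr hq).ne'
  have hr2 : r * r * minkowskiForm x x = minkowskiForm y y := by
    rw [Real.mul_self_sqrt hq.le, div_mul_cancel₀ _ hxx.ne]
  have hH := isSimilarityAlong_homothety u hr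
  by_cases hw0 : r • x - y = 0
  · exact ⟨_, hH, by simpa using sub_eq_zero.mp hw0⟩
  -- the reflection in the difference of two vectors of equal length interchanges them
  have hwu : minkowskiForm (r • x - y) u = 0 := by simp [hx, hy]
  have hww := (minkowskiForm_self_neg hu hwu hw0).ne
  have huR : minkowskiReflection _ hww u = u :=
    minkowskiReflection_of_orthogonal hww (by rw [minkowskiForm_comm, hwu])
  have hR : IsSimilarityAlong u (minkowskiReflection _ hww) :=
    ⟨⟨1, one_pos, fun v => by rw [minkowskiForm_reflection, one_mul]⟩, 1, one_ne_zero,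
      by rw [huR, one_smul]⟩
  refine ⟨_, hH.trans hR, ?_⟩
  have key : 2 * minkowskiForm (r • x) (r • x - y)
      = minkowskiForm (r • x - y) (r • x - y) := by
    simp only [map_sub, map_smul, LinearMap.sub_apply, LinearMap.smul_apply, smul_eq_mul,
      minkowskiForm_comm y x]
    linear_combination hr2
  rw [LinearEquiv.trans_apply, LinearEquiv.smulOfNeZero_apply, minkowskiReflection_apply,
    div_mul_eq_mul_div, key, div_self hww, one_smul, sub_sub_cancel]

/-- The affine map with linear part `L` that carries `a` to `a + s u` stabilises the line
`a + ℝ u` and preserves the causal relation. -/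
theorem exists_causalAutStab_of_similarity (a : Spacetime) {u : Spacetime}
    {L : Spacetime ≃ₗ[ℝ] Spacetime} (hL : IsSimilarityAlong u L) (s : ℝ) :
    ∃ f ∈ causalAutStab (Set.range (fun s : ℝ => a + s • u)),
      ∀ v, f (a + v) = a + (s • u + L v) := by
  obtain ⟨⟨c, hc, hc'⟩, k, hk, hk'⟩ := hL
  let f : Equiv.Perm Spacetime :=
    ((Equiv.subRight a).trans L.toEquiv).trans (Equiv.addLeft (a + s • u))
  have hf : ∀ p, f p = a + s • u + L (p - a) := fun p => rfl
  refine ⟨f, ⟨fun p q => ?_, ?_⟩, fun v => by rw [hf, add_sub_cancel_left, add_assoc]⟩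
  · have : f p - f q = L (p - q) := by
      rw [hf, hf, add_sub_add_left_eq_sub, ← map_sub, sub_sub_sub_cancel_right]
    simp only [IsSpacelike, this, ← minkowskiForm_apply, hc', not_lt, mul_nonneg_iff_of_pos_left hc]
  · refine MulAction.mem_stabilizer_iff.mpr ?_
    ext p
    simp only [Set.mem_smul_set, Set.mem_range, Equiv.Perm.smul_def]
    constructor
    · rintro ⟨_, ⟨t, rfl⟩, rfl⟩
      refine ⟨s + t * k, ?_⟩
      rw [hf, add_sub_cancel_left, map_smul, hk', smul_smul, add_smul, add_assoc]
    · rintro ⟨t, rfl⟩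
      refine ⟨_, ⟨(t - s) / k, rfl⟩, ?_⟩
      rw [hf, add_sub_cancel_left, map_smul, hk', smul_smul, div_mul_cancel₀ _ hk, sub_smul]
      abel

/-! ### Invariant equivalence relations -/

/-- Invariance of an equivalence relation under the affine maps `v ↦ s u + L v`, where `L` is a
similarity preserving `ℝ u`: the symmetries of the line `ℝ u` through the origin. -/
def SimilarityInvariant (u : Spacetime) (R : Setoid Spacetime) : Prop :=
  ∀ L, IsSimilarityAlong u L → ∀ (s : ℝ) (v w : Spacetime),
    R v w → R (s • u + L v) (s • u + L w)

namespace SimilarityInvariant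

variable {u : Spacetime} {R : Setoid Spacetime}

theorem translate (hR : SimilarityInvariant u R) (s : ℝ) {v w : Spacetime} (h : R v w) :
    R (s • u + v) (s • u + w) := by
  simpa using hR _ (isSimilarityAlong_homothety u one_ne_zero) s v w h

theorem homothety (hR : SimilarityInvariant u R) {r : ℝ} (hr : r ≠ 0) {v w : Spacetime}
    (h : R v w) : R (r • v) (r • w) := by
  simpa using hR _ (isSimilarityAlong_homothety u hr) 0 v w h

theorem line_of_ne (hR : SimilarityInvariant u R) {s s' : ℝ} (hs : s ≠ s')
    (h : R (s • u) (s' • u)) (r : ℝ) : R 0 (r • u) := by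
  rcases eq_or_ne r 0 with rfl | hr
  · rw [zero_smul]
  have h1 : R 0 ((s' - s) • u) := by
    have := hR.translate (-s) h
    rwa [← add_smul, ← add_smul, neg_add_cancel, zero_smul, neg_add_eq_sub] at this
  have hd : s' - s ≠ 0 := sub_ne_zero.mpr hs.symm
  have := hR.homothety (div_ne_zero hr hd) h1
  rwa [smul_zero, smul_smul, div_mul_cancel₀ _ hd] at this

/-- A relation between the origin and a point off the line propagates to every spatial
displacement `y`, the time component being rescaled. -/
theorem exists_rel_add (hR : SimilarityInvariant u R) (hu : IsTimelike u) {t : ℝ}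
    {x y : Spacetime} (hx : minkowskiForm x u = 0) (hx0 : x ≠ 0) (h : R 0 (t • u + x))
    (hy : minkowskiForm y u = 0) : ∃ k : ℝ, R 0 ((t * k) • u + y) := by
  rcases eq_or_ne y 0 with rfl | hy0
  · exact ⟨0, by simp⟩
  obtain ⟨L, hL, hLx⟩ := exists_similarity_map_orthogonal hu hx hx0 hy hy0
  obtain ⟨k, -, hk⟩ := hL.2
  refine ⟨k, ?_⟩
  have := hR L hL 0 _ _ h
  rwa [zero_smul, zero_add, zero_add, map_zero, map_add, map_smul, hk, hLx, smul_smul] at this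

theorem top_of_line (hR : SimilarityInvariant u R) (hu : IsTimelike u) {t : ℝ} {x : Spacetime}
    (hx : minkowskiForm x u = 0) (hx0 : x ≠ 0) (h : R 0 (t • u + x))
    (hline : ∀ r : ℝ, R 0 (r • u)) : R = ⊤ := by
  have h0 : ∀ v, R 0 v := fun v => by
    obtain ⟨s, y, hy, rfl⟩ := exists_eq_smul_add_orthogonal hu v
    obtain ⟨k, hk⟩ := hR.exists_rel_add hu hx hx0 h hy
    have := hR.translate (s - t * k) hk
    rw [add_zero, ← add_assoc, ← add_smul, sub_add_cancel] at this
    exact R.trans (hline _) this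
  exact Setoid.eq_top_iff.mpr fun v w => R.trans (R.symm (h0 v)) (h0 w)

/-- An invariant relation with more than one class that relates the origin to a point off the
timelike line `ℝ u` is simultaneity with respect to `u`. -/
theorem rel_iff_orthogonal (hR : SimilarityInvariant u R) (hu : IsTimelike u) (htop : R ≠ ⊤)
    {t : ℝ} {x : Spacetime} (hx : minkowskiForm x u = 0) (hx0 : x ≠ 0) (h : R 0 (t • u + x))
    (v w : Spacetime) : R v w ↔ minkowskiForm (v - w) u = 0 := by
  have huu : minkowskiForm u u ≠ 0 := ne_of_gt hu
  have hline : ∀ s s' : ℝ, R (s • u) (s' • u) → s = s' := fun s s' hss => by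
    by_contra hne
    exact htop (hR.top_of_line hu hx hx0 h (hR.line_of_ne hne hss))
  have ht : t = 0 := by
    have hT : IsSimilarityAlong u (minkowskiReflection u huu) :=
      ⟨⟨1, one_pos, fun v => by rw [minkowskiForm_reflection, one_mul]⟩, -1,
        neg_ne_zero.mpr one_ne_zero, by rw [minkowskiReflection_self, neg_one_smul]⟩
    -- time reflection about the event `t u`
    have h2 := hR _ hT (2 * t) _ _ h
    rw [map_zero, map_add, map_smul, minkowskiReflection_self,
      minkowskiReflection_of_orthogonal huu hx, add_zero, smul_neg, ← neg_smul, ← add_assoc,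
      ← add_smul, show 2 * t + -t = t by ring] at h2
    have h3 : R ((0 : ℝ) • u) ((2 * t) • u) := by
      rw [zero_smul]
      exact R.trans h (R.symm h2)
    linarith [hline _ _ h3]
  subst ht
  have hproj : ∀ (s : ℝ) (y : Spacetime), minkowskiForm y u = 0 → R (s • u) (s • u + y) :=
    fun s y hy => by
      obtain ⟨k, hk⟩ := hR.exists_rel_add hu hx hx0 h hy
      simpa using hR.translate s hk
  obtain ⟨s, y, hy, rfl⟩ := exists_eq_smul_add_orthogonal hu v
  obtain ⟨s', y', hy', rfl⟩ := exists_eq_smul_add_orthogonal hu w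
  have hform : minkowskiForm (s • u + y - (s' • u + y')) u = (s - s') * minkowskiForm u u := by
    simp [hy, hy']
    ring
  rw [hform, mul_eq_zero, or_iff_left huu, sub_eq_zero]
  constructor
  · intro hvw
    exact hline _ _ (R.trans (R.trans (hproj s y hy) hvw) (R.symm (hproj s' y' hy')))
  · rintro rfl
    exact R.trans (R.symm (hproj s y hy)) (hproj s y' hy')

end SimilarityInvariant

theorem einsteinSimultaneity_iff (a u p q : Spacetime) :
    einsteinSimultaneity (Set.range (fun s : ℝ => a + s • u)) p q
      ↔ minkowskiForm (p - q) u = 0 := by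
  constructor
  · intro h
    have := h (a + (0 : ℝ) • u) ⟨0, rfl⟩ (a + (1 : ℝ) • u) ⟨1, rfl⟩
    simpa [← minkowskiForm_apply] using this
  · rintro h _ ⟨s, rfl⟩ _ ⟨s', rfl⟩
    simp only [← minkowskiForm_apply]
    rw [add_sub_add_left_eq_sub, ← sub_smul, map_smul, h, smul_zero]

theorem theorem7 (X : Set Spacetime) (hX : IsTimelikeLine X)
    (S : Setoid Spacetime) (hS : S.NonTrivial)
    (hinv : S.InvariantUnder (causalAutStab X))
    (hrel : ∃ p ∈ X, ∃ q, q ∉ X ∧ S p q) :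
    S = einsteinSimultaneity X := by
  obtain ⟨a, u, hu, rfl⟩ := hX
  obtain ⟨_, ⟨s, rfl⟩, q, hq, hpq⟩ := hrel
  -- the relation seen from the origin `a`
  let R : Setoid Spacetime := S.comap (fun v => a + v)
  have hRS : ∀ v w, R v w ↔ S (a + v) (a + w) := fun _ _ => Iff.rfl
  have hSR : ∀ p q, S p q ↔ R (p - a) (q - a) := fun p q => by
    rw [hRS, add_sub_cancel, add_sub_cancel]
  have hR : SimilarityInvariant u R := fun L hL s v w h => by
    obtain ⟨f, hf, hfv⟩ := exists_causalAutStab_of_similarity a hL s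
    rw [hRS, ← hfv, ← hfv]
    exact (hinv f hf _ _).mp h
  have htop : R ≠ ⊤ := fun h => hS.2 <| Setoid.eq_top_iff.mpr fun p q => by
    rw [hSR, h]
    trivial
  obtain ⟨t, x, hx, hqx⟩ := exists_eq_smul_add_orthogonal hu (q - a)
  have hx0 : x ≠ 0 := by
    rintro rfl
    exact hq ⟨t, by rw [add_zero] at hqx; simp [← hqx]⟩
  have h0 : R 0 ((-s + t) • u + x) := by
    have h1 := (hSR _ _).mp hpq
    rw [add_sub_cancel_left, hqx] at h1
    have h2 := hR.translate (-s) h1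
    rwa [← add_smul, neg_add_cancel, zero_smul, ← add_assoc, ← add_smul] at h2
  refine Setoid.ext fun p q => ?_
  rw [hSR, hR.rel_iff_orthogonal hu htop hx hx0 h0, einsteinSimultaneity_iff,
    sub_sub_sub_cancel_right]
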